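/- **Theorem 6.3 (Nielsen–Schreier is false in nominal sets).** Let $\mathbb{A}$ be a countably infinite set and let $\mathrm{Perm}(\mathbb{A})$ be the group of permutations $\pi$ of $\mathbb{A}$ with $\pi(a)=a$ for all but finitely many $a$. A set $A\subseteq\mathbb{A}$ is a support of an element $x$ of a $\mathrm{Perm}(\mathbb{A})$-set if $\pi\cdot x=x$ whenever $\pi\in\mathrm{Perm}(\mathbb{A})$ fixes every element of $A$. The topos of nominal sets has as objects the $\mathrm{Perm}(\mathbb{A})$-sets all of whose elements have a finite support, and as morphisms the equivariant maps. The Nielsen–Schreier theorem, "for every set $A$, every free group $F$ on $A$ and every subgroup $H\le F$ there exists a subset $X\subseteq H$ that freely generates $H$", is false in the internal logic (Kripke–Joyal semantics, with quantification over sets and groups interpreted by objects and group objects of slices) of the topos of nominal sets: the statement does not hold there, and its negation does. The following is a witness. Let $F_{\mathbb{A}}$ be the free group on $\mathbb{A}$, with $\mathrm{Perm}(\mathbb{A})$ permuting the letters, and let $C\le F_{\mathbb{A}}$ be the subgroup generated by the elements $aba^{-1}b^{-1}$ with $a,b\in\mathbb{A}$, with the restricted action. In the internal logic, $F_{\mathbb{A}}$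 is the free group on $\mathbb{A}$, $C$ is a subgroup of $F_{\mathbb{A}}$, and no subset of $C$ freely generates $C$. Externally, no finitely supported subset $X\subseteq C$ freely generates $C$. -/

import Mathlib

open CategoryTheory Limits MonoidalCategory CartesianMonoidalCategory
open scoped Pointwise

universe u v w

/-! ### Forcing (Kripke-Joyal / stack semantics) for statements about groups

Let `E` be a category with pullbacks (in the application, a topos). A statement of the internal
language is interpreted at every stage `U : E`; at stage `U` a set is an object of `Over U`, a
group is a group object of `Over U`, and both are restricted along `p : V ⟶ U` by pullback.
The clauses are the usual ones:
* `U ⊩ ∀ x, φ x` iff `V ⊩ φ x` for all `V ⟶ U` and all `x` at stage `V`;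
* `U ⊩ ∃ x, φ x` iff there are an epimorphism `V ⟶ U` and an `x` at stage `V` with `V ⊩ φ x`;
* `U ⊩ φ → ψ` iff `V ⊩ φ` implies `V ⊩ ψ` for all `V ⟶ U`;
* `U ⊩ ⊥` iff `U` is initial, and so `U ⊩ ¬ φ` iff every `V ⟶ U` with `V ⊩ φ` is initial.
A closed statement holds in the internal logic iff it is forced at the terminal object. -/

namespace InternalLogic

noncomputable section

attribute [local instance] Over.cartesianMonoidalCategory Over.braidedCategory

variable {E : Type u} [Category.{v} E] [HasPullbacks E]

/-- A group of the internal language at stage `U`: a group object of the slice over `U`. -/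
abbrev GroupAt (U : E) := Grp (Over U)

/-- The underlying set of a group at stage `U`. -/
abbrev GroupAt.set {U : E} (G : GroupAt U) : Over U := G.X

/-- The underlying map of a homomorphism of groups at stage `U`. -/
abbrev GroupAt.mapOf {U : E} {G H : GroupAt U} (φ : G ⟶ H) : G.set ⟶ H.set := φ.hom.hom

/-- Restriction of groups along `p : V ⟶ U`: the pullback functor, applied to group objects.
The underlying set of `(GroupAt.restrict p).obj G` is `(Over.pullback p).obj G.set`. -/
abbrev GroupAt.restrict {V U : E} (p : V ⟶ U) : GroupAt U ⥤ GroupAt V :=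
  (Over.pullback p).mapGrp

/-- `U ⊩ "the map i : X → H freely generates the group H"`, where the statement in quotes is the
universal property: for every group `G` and every map `g : X → G` there is a unique homomorphism
`φ : H → G` with `φ ∘ i = g`. -/
def ForcesFreelyGenerates {U : E} (H : GroupAt U) {X : Over U} (i : X ⟶ H.set) : Prop :=
  ∀ ⦃V : E⦄ (p : V ⟶ U) (G : GroupAt V) (g : (Over.pullback p).obj X ⟶ G.set),
    ∃! φ : (GroupAt.restrict p).obj H ⟶ G, (Over.pullback p).map i ≫ GroupAt.mapOf φ = g

/-- `U ⊩ "there is a subset X of the group H that freely generates H"`. -/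
def ForcesHasFreeGeneratingSubset (U : E) (H : GroupAt U) : Prop :=
  ∃ (W : E) (q : W ⟶ U) (X : Over W) (i : X ⟶ ((GroupAt.restrict q).obj H).set),
    Epi q ∧ Mono i ∧ ForcesFreelyGenerates ((GroupAt.restrict q).obj H) i

/-- `U ⊩ "the Nielsen-Schreier theorem"`, that is, `U ⊩ "for every set A, every free group F on A
(with unit η : A → F) and every subgroup m : H ↪ F, there is a subset of H that freely
generates H"`. An object at an earlier stage can be restricted to a later one, so that all the
universally quantified objects are introduced at the same stage `V`. -/
def ForcesNielsenSchreier (U : E) : Prop :=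
  ∀ ⦃V : E⦄ (_ : V ⟶ U) (A : Over V) (F : GroupAt V) (η : A ⟶ F.set),
    ForcesFreelyGenerates F η →
      ∀ (H : GroupAt V) (m : H ⟶ F), Mono (GroupAt.mapOf m) → ForcesHasFreeGeneratingSubset V H

/-- `U ⊩ ¬ φ`, where `φ V f` is the assertion that `V` forces the restriction of `φ`
along `f : V ⟶ U`. -/
def ForcesNot (U : E) (φ : ∀ V : E, (V ⟶ U) → Prop) : Prop :=
  ∀ (V : E) (f : V ⟶ U), φ V f → Nonempty (IsInitial V)

end

end InternalLogic

/-! ### Nominal sets -/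

/-- `Perm(𝔸)`: the permutations `π` of `𝔸` with `π a = a` for all but finitely many `a`. -/
def FinPerm (𝔸 : Type u) : Subgroup (Equiv.Perm 𝔸) where
  carrier := {π | {a | π a ≠ a}.Finite}
  one_mem' := by simp
  mul_mem' := by
    intro π σ hπ hσ
    refine (Set.Finite.union hπ hσ).subset ?_
    intro a ha
    by_contra h
    simp only [Set.mem_union, Set.mem_ofPred_eq, not_or, not_not] at h
    exact ha (by rw [Equiv.Perm.mul_apply, h.2, h.1])
  inv_mem' := by
    intro π hπ
    refine Set.Finite.subset hπ ?_
    intro a ha h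
    exact ha (Equiv.Perm.inv_eq_iff_eq.mpr h.symm)

/-- `S` is a support for `x` iff every `π : Perm(𝔸)` that fixes all elements of `S` satisfies
`π • x = x`; the element `x` is finitely supported if it has a finite support. -/
def FinitelySupported (𝔸 : Type u) {X : Type v} [SMul (FinPerm 𝔸) X] (x : X) : Prop :=
  ∃ S : Set 𝔸, S.Finite ∧ MulAction.Supports (FinPerm 𝔸) S x

/-- A nominal set: a `Perm(𝔸)`-set in which every element has a finite support. -/
structure NominalSet (𝔸 : Type u) where
  /-- The underlying set. -/
  carrier : Type u
  [action : MulAction (FinPerm 𝔸) carrier]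
  finitelySupported : ∀ x : carrier, FinitelySupported 𝔸 x

namespace NominalSet

attribute [instance] NominalSet.action

variable {𝔸 : Type u}

/-- Morphisms of nominal sets are the equivariant maps. -/
instance : Category (NominalSet 𝔸) where
  Hom X Y := X.carrier →[FinPerm 𝔸] Y.carrier
  id X := MulActionHom.id (FinPerm 𝔸)
  comp f g := g.comp f

/-- The equivariant map underlying a morphism of nominal sets. -/
abbrev toMap {X Y : NominalSet 𝔸} (f : X ⟶ Y) : X.carrier →[FinPerm 𝔸] Y.carrier := f

/-- An equivariant map, as a morphism of nominal sets. -/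
abbrev ofMap {X Y : NominalSet 𝔸} (f : X.carrier →[FinPerm 𝔸] Y.carrier) : X ⟶ Y := f

theorem comp_toMap {X Y Z : NominalSet 𝔸} (f : X ⟶ Y) (g : Y ⟶ Z) (x : X.carrier) :
    toMap (f ≫ g) x = toMap g (toMap f x) := rfl

theorem hom_ext {X Y : NominalSet 𝔸} {f g : X ⟶ Y} (h : ∀ x, toMap f x = toMap g x) : f = g :=
  MulActionHom.ext h

/-- The fibre product of nominal sets. -/
def fibreProduct {X Y Z : NominalSet 𝔸} (f : X ⟶ Z) (g : Y ⟶ Z) : NominalSet 𝔸 where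
  carrier := {p : X.carrier × Y.carrier // toMap f p.1 = toMap g p.2}
  action :=
    { smul := fun π p => ⟨π • p.1, by
        simp only [Prod.smul_fst, Prod.smul_snd, map_smul, p.2]⟩
      one_smul := fun p => Subtype.ext (one_smul _ p.1)
      mul_smul := fun π σ p => Subtype.ext (mul_smul π σ p.1) }
  finitelySupported := by
    rintro ⟨⟨x, y⟩, h⟩
    obtain ⟨S, hS, hx⟩ := X.finitelySupported x
    obtain ⟨T, hT, hy⟩ := Y.finitelySupported y
    refine ⟨S ∪ T, hS.union hT, fun π hπ => Subtype.ext (Prod.ext ?_ ?_)⟩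
    · exact hx π fun a ha => hπ (Or.inl ha)
    · exact hy π fun a ha => hπ (Or.inr ha)

instance : HasPullbacks (NominalSet 𝔸) := by
  refine @hasPullbacks_of_hasLimit_cospan _ _ ?_
  intro X Y Z f g
  let p₁ : fibreProduct f g ⟶ X := ofMap
    { toFun := fun p => p.1.1, map_smul' := fun _ _ => rfl }
  let p₂ : fibreProduct f g ⟶ Y := ofMap
    { toFun := fun p => p.1.2, map_smul' := fun _ _ => rfl }
  have w : p₁ ≫ f = p₂ ≫ g := hom_ext fun p => p.2
  refine HasLimit.mk ⟨PullbackCone.mk p₁ p₂ w, PullbackCone.IsLimit.mk w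
    (fun s => ofMap
      { toFun := fun x => ⟨(toMap s.fst x, toMap s.snd x), by
          rw [← comp_toMap, ← comp_toMap, s.condition]⟩
        map_smul' := fun π x => Subtype.ext (Prod.ext
          (map_smul (toMap s.fst) π x) (map_smul (toMap s.snd) π x)) })
    (fun s => rfl) (fun s => rfl) ?_⟩
  intro s m h₁ h₂
  refine hom_ext fun x => Subtype.ext (Prod.ext ?_ ?_)
  · exact DFunLike.congr_fun (show toMap (m ≫ p₁) = toMap s.fst from h₁) x
  · exact DFunLike.congr_fun (show toMap (m ≫ p₂) = toMap s.snd from h₂) x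

/-- The terminal nominal set: one point. -/
def one (𝔸 : Type u) : NominalSet 𝔸 where
  carrier := PUnit
  action := { smul := fun _ x => x, one_smul := fun _ => rfl, mul_smul := fun _ _ _ => rfl }
  finitelySupported := fun _ => ⟨∅, Set.finite_empty, fun _ _ => rfl⟩

/-- The map from a nominal set to the terminal one. -/
def toOne (X : NominalSet 𝔸) : X ⟶ one 𝔸 := ofMap
  { toFun := fun _ => PUnit.unit, map_smul' := fun _ _ => rfl }

/-- A nominal set as an object of the slice over the terminal nominal set. -/
abbrev overOne (X : NominalSet 𝔸) : Over (one 𝔸) := Over.mk (toOne X)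

/-- A morphism of nominal sets as a morphism of the slice over the terminal nominal set. -/
abbrev overOneMap {X Y : NominalSet 𝔸} (f : X ⟶ Y) : overOne X ⟶ overOne Y :=
  Over.homMk f rfl

/-- `one 𝔸` is a terminal object. -/
def oneIsTerminal (𝔸 : Type u) : IsTerminal (one 𝔸) :=
  IsTerminal.ofUniqueHom toOne fun _ _ => hom_ext fun _ => rfl

section Groups

attribute [local instance] Over.cartesianMonoidalCategory Over.braidedCategory

/-- The nominal set underlying a group with a finitely supported action by automorphisms. -/
abbrev ofGroup (G : Type u) [Group G] [MulDistribMulAction (FinPerm 𝔸) G]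
    (hG : ∀ x : G, FinitelySupported 𝔸 x) : NominalSet 𝔸 where
  carrier := G
  finitelySupported := hG

/-- The equivariant maps from a `Perm(𝔸)`-set to a group on which `Perm(𝔸)` acts by
automorphisms form a group under pointwise multiplication. -/
abbrev pointwiseGroup (T G : Type u) [MulAction (FinPerm 𝔸) T] [Group G]
    [MulDistribMulAction (FinPerm 𝔸) G] : Group (T →[FinPerm 𝔸] G) where
  mul f g := { toFun := fun x => f x * g x, map_smul' := fun π x => by simp [smul_mul'] }
  one := { toFun := fun _ => 1, map_smul' := fun π x => by simp }
  inv f := { toFun := fun x => (f x)⁻¹, map_smul' := fun π x => by simp [smul_inv'] }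
  mul_assoc f g h := MulActionHom.ext fun x => mul_assoc (f x) (g x) (h x)
  one_mul f := MulActionHom.ext fun x => one_mul (f x)
  mul_one f := MulActionHom.ext fun x => mul_one (f x)
  inv_mul_cancel f := MulActionHom.ext fun x => inv_mul_cancel (f x)

attribute [local instance] pointwiseGroup

/-- The presheaf of groups `T ↦ {equivariant maps T → G}` on the slice over `one 𝔸`. -/
def groupPresheaf (𝔸 : Type u) (G : Type u) [Group G] [MulDistribMulAction (FinPerm 𝔸) G] :
    (Over (one 𝔸))ᵒᵖ ⥤ GrpCat.{u} where
  obj T := GrpCat.of (T.unop.left.carrier →[FinPerm 𝔸] G)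
  map {S T} f := GrpCat.ofHom (MonoidHom.mk' (M := S.unop.left.carrier →[FinPerm 𝔸] G)
    (G := T.unop.left.carrier →[FinPerm 𝔸] G)
    (fun h => h.comp (toMap f.unop.left)) (fun _ _ => rfl))
  map_id _ := rfl
  map_comp _ _ := rfl

/-- A group with a finitely supported action of `Perm(𝔸)` by automorphisms is a group object over
the terminal nominal set; its multiplication is that of `G`, since maps into it are multiplied
pointwise. -/
noncomputable def groupOverOne (G : Type u) [Group G] [MulDistribMulAction (FinPerm 𝔸) G]
    (hG : ∀ x : G, FinitelySupported 𝔸 x) : InternalLogic.GroupAt (one 𝔸) :=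
  letI : GrpObj (overOne (ofGroup G hG)) :=
    GrpObj.ofRepresentableBy (overOne (ofGroup G hG)) (groupPresheaf 𝔸 G)
      { homEquiv := fun {T} =>
          { toFun := fun f => (toMap f.left : T.left.carrier →[FinPerm 𝔸] G)
            invFun := fun f => Over.homMk (ofMap (show T.left.carrier →[FinPerm 𝔸] G from f)) rfl
            left_inv := fun _ => rfl
            right_inv := fun _ => rfl }
        homEquiv_comp := fun _ _ => rfl }
  ⟨overOne (ofGroup G hG)⟩

/-- The multiplication of `groupOverOne G` is pointwise the multiplication of `G`. -/
theorem groupOverOne_mul_apply (G : Type u) [Group G] [MulDistribMulAction (FinPerm 𝔸) G]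
    (hG : ∀ x : G, FinitelySupported 𝔸 x)
    (z : ((groupOverOne G hG).X ⊗ (groupOverOne G hG).X : Over (one 𝔸)).left.carrier) :
    toMap (MonObj.mul (X := (groupOverOne G hG).X)).left z =
      (show G from toMap (fst (groupOverOne G hG).X (groupOverOne G hG).X).left z) *
        (show G from toMap (snd (groupOverOne G hG).X (groupOverOne G hG).X).left z) := rfl

/-- An equivariant group homomorphism, as a homomorphism of group objects over the terminal
nominal set. -/
noncomputable def groupOverOneMap {G K : Type u} [Group G] [MulDistribMulAction (FinPerm 𝔸) G]
    [Group K] [MulDistribMulAction (FinPerm 𝔸) K]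
    (hG : ∀ x : G, FinitelySupported 𝔸 x) (hK : ∀ x : K, FinitelySupported 𝔸 x)
    (φ : G →*[FinPerm 𝔸] K) : groupOverOne G hG ⟶ groupOverOne K hK :=
  let f : overOne (ofGroup G hG) ⟶ overOne (ofGroup K hK) :=
    overOneMap (ofMap (X := ofGroup G hG) (Y := ofGroup K hK) φ.toMulActionHom)
  Grp.homMk'' (A := groupOverOne G hG) (B := groupOverOne K hK) f
    (by
      refine Over.OverMorphism.ext (hom_ext fun x => ?_)
      exact map_one φ)
    (by
      have h₁ : (f ⊗ₘ f) ≫ fst _ _ = fst _ _ ≫ f := tensorHom_fst f f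
      have h₂ : (f ⊗ₘ f) ≫ snd _ _ = snd _ _ ≫ f := tensorHom_snd f f
      refine Over.OverMorphism.ext (hom_ext fun x => ?_)
      have e₁ := congrArg (fun g => toMap g.left x) h₁
      have e₂ := congrArg (fun g => toMap g.left x) h₂
      refine (map_mul φ _ _).trans ?_
      exact (congrArg₂ (fun a b : K => a * b) e₁ e₂).symm)

end Groups

end NominalSet

/-! ### The free group on the set of atoms and its subgroup generated by commutators -/

/-- `Perm(𝔸)` acts on the free group on `𝔸` by permuting the letters. -/
instance FreeGroup.finPermAction (𝔸 : Type u) :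
    MulDistribMulAction (FinPerm 𝔸) (FreeGroup 𝔸) where
  smul π x := FreeGroup.map (fun a => π • a) x
  one_smul x := by
    change FreeGroup.map (fun a => (1 : FinPerm 𝔸) • a) x = x
    simp only [one_smul]
    exact FreeGroup.map.id' x
  mul_smul π σ x := by
    change FreeGroup.map (fun a => (π * σ) • a) x =
      FreeGroup.map (fun a => π • a) (FreeGroup.map (fun a => σ • a) x)
    rw [FreeGroup.map.comp]
    simp only [mul_smul]
    rfl
  smul_mul π := _root_.map_mul (FreeGroup.map fun a => π • a)
  smul_one π := _root_.map_one (FreeGroup.map fun a => π • a)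

theorem FreeGroup.finPerm_smul_of {𝔸 : Type u} (π : FinPerm 𝔸) (a : 𝔸) :
    π • FreeGroup.of a = FreeGroup.of (π • a) := FreeGroup.map.of

theorem FreeGroup.finitelySupported {𝔸 : Type u} (x : FreeGroup 𝔸) : FinitelySupported 𝔸 x := by
  induction x using FreeGroup.induction_on with
  | C1 => exact ⟨∅, Set.finite_empty, fun π _ => smul_one π⟩
  | of a =>
    refine ⟨{a}, Set.finite_singleton a, fun π hπ => ?_⟩
    exact (FreeGroup.finPerm_smul_of π a).trans (congrArg _ (hπ rfl))
  | inv_of a h =>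
    obtain ⟨S, hS, h⟩ := h
    exact ⟨S, hS, fun π hπ => by rw [smul_inv', h π hπ]⟩
  | mul x y hx hy =>
    obtain ⟨S, hS, hx⟩ := hx
    obtain ⟨T, hT, hy⟩ := hy
    refine ⟨S ∪ T, hS.union hT, fun π hπ => ?_⟩
    rw [smul_mul', hx π fun a ha => hπ (Or.inl ha), hy π fun a ha => hπ (Or.inr ha)]

/-- The subgroup `C` of the free group on `𝔸` generated by all `a b a⁻¹ b⁻¹` with `a, b ∈ 𝔸`. -/
def commutatorSubgroupOfLetters (𝔸 : Type u) : Subgroup (FreeGroup 𝔸) :=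
  Subgroup.closure {x | ∃ a b : 𝔸, x =
    FreeGroup.of a * FreeGroup.of b * (FreeGroup.of a)⁻¹ * (FreeGroup.of b)⁻¹}

theorem commutatorSubgroupOfLetters_smul_mem {𝔸 : Type u} (π : FinPerm 𝔸) {x : FreeGroup 𝔸}
    (hx : x ∈ commutatorSubgroupOfLetters 𝔸) : π • x ∈ commutatorSubgroupOfLetters 𝔸 := by
  induction hx using Subgroup.closure_induction with
  | mem x hx =>
    obtain ⟨a, b, rfl⟩ := hx
    refine Subgroup.subset_closure ⟨π • a, π • b, ?_⟩
    simp only [smul_mul', smul_inv', FreeGroup.finPerm_smul_of]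
  | one => rw [smul_one]; exact one_mem _
  | mul x y _ _ hx hy => rw [smul_mul']; exact mul_mem hx hy
  | inv x _ hx => rw [smul_inv']; exact inv_mem hx

/-- The action on the free group restricts to `C`. -/
instance commutatorSubgroupOfLetters.action (𝔸 : Type u) :
    MulDistribMulAction (FinPerm 𝔸) (commutatorSubgroupOfLetters 𝔸) where
  smul π x := ⟨π • (x : FreeGroup 𝔸), commutatorSubgroupOfLetters_smul_mem π x.2⟩
  one_smul x := Subtype.ext (one_smul _ (x : FreeGroup 𝔸))
  mul_smul π σ x := Subtype.ext (mul_smul π σ (x : FreeGroup 𝔸))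
  smul_mul π x y := Subtype.ext (smul_mul' π (x : FreeGroup 𝔸) (y : FreeGroup 𝔸))
  smul_one π := Subtype.ext (smul_one π)

theorem commutatorSubgroupOfLetters.finitelySupported {𝔸 : Type u}
    (x : commutatorSubgroupOfLetters 𝔸) : FinitelySupported 𝔸 x := by
  obtain ⟨S, hS, h⟩ := FreeGroup.finitelySupported (x : FreeGroup 𝔸)
  exact ⟨S, hS, fun π hπ => Subtype.ext (h π hπ)⟩

/-- The subset `X` of `H` freely generates the subgroup `H`: the homomorphism from the free group
on `X` to `H` that extends the inclusion is an isomorphism. -/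
def FreelyGenerates {G : Type u} [Group G] (X : Set G) (H : Subgroup G) : Prop :=
  ∃ hX : X ⊆ H, Function.Bijective (FreeGroup.lift fun x : X => (⟨x, hX x.2⟩ : H))

namespace NominalSet

section Witness

attribute [local instance] Over.cartesianMonoidalCategory Over.braidedCategory

/-- The nominal set `𝔸` of atoms, with the action `π • a = π a`. -/
def atoms (𝔸 : Type u) : NominalSet 𝔸 where
  carrier := 𝔸
  finitelySupported := fun a => ⟨{a}, Set.finite_singleton a, fun _ hπ => hπ rfl⟩

/-- The group `F_𝔸` of the internal language of nominal sets. -/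
noncomputable def freeGroup (𝔸 : Type u) : InternalLogic.GroupAt (one 𝔸) :=
  groupOverOne (FreeGroup 𝔸) FreeGroup.finitelySupported

/-- The map `𝔸 → F_𝔸` that sends a letter to the corresponding word. -/
noncomputable def letters (𝔸 : Type u) : overOne (atoms 𝔸) ⟶ (freeGroup 𝔸).X :=
  overOneMap (X := atoms 𝔸) (Y := ofGroup (FreeGroup 𝔸) FreeGroup.finitelySupported) (ofMap
    { toFun := fun a : 𝔸 => FreeGroup.of a
      map_smul' := fun π a => (FreeGroup.finPerm_smul_of π a).symm })

/-- The group `C` of the internal language of nominal sets. -/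
noncomputable def commutatorGroup (𝔸 : Type u) : InternalLogic.GroupAt (one 𝔸) :=
  groupOverOne (commutatorSubgroupOfLetters 𝔸) commutatorSubgroupOfLetters.finitelySupported

/-- The inclusion homomorphism `C → F_𝔸`. -/
noncomputable def commutatorInclusion (𝔸 : Type u) : commutatorGroup 𝔸 ⟶ freeGroup 𝔸 :=
  groupOverOneMap _ _
    { toFun := fun x : commutatorSubgroupOfLetters 𝔸 => (x : FreeGroup 𝔸)
      map_smul' := fun _ _ => rfl
      map_one' := rfl
      map_mul' := fun _ _ => rfl }

end Witness

end NominalSet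

/-! The obstruction is that the transposition τ of two atoms a ≠ b inverts the commutator [a,b].
There is a τ-invariant homomorphism χ : C → ℤ/2 with χ([a,b]) = 1 (`exists_commutatorParity`,
`commutatorParity_smul`). If C is free on a set X preserved by τ, then χ on X, followed by a section
of sets ℤ/2 → ℤ/4, extends to a homomorphism f : C → ℤ/4 that lifts χ. Its values on X are
τ-invariant, hence so is f. Thus f([a,b]) equals its own inverse, so it is even, contradicting
χ([a,b]) = 1. A finitely supported X is preserved by τ once a and b avoid a finite support.

Internally the same lift exists by the universal property, and it is equivariant because it is a
morphism. A stage with a point w admits a transposition fixing w, which therefore acts on the fibre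
over w, and the computation takes place there (`not_forcesFreelyGenerates_commutatorGroup`).

For the positive claim about F_𝔸, a group object over V is treated as a family of groups permuted by
Perm(𝔸). If every fibre is free, the unique homomorphisms on fibres assemble to an equivariant one,
and this condition is stable under pullback (`FibrewiseFree.forcesFreelyGenerates`). -/

namespace NominalSet

open InternalLogic

variable {𝔸 : Type u}

/-! ### Elements of pullbacks and of slices -/

section Pullback

variable {X Y Z : NominalSet 𝔸} (f : X ⟶ Z) (g : Y ⟶ Z)

/-- The canonical map from the concrete fibre product to the chosen pullback. -/
noncomputable def fibreProductToPullback : fibreProduct f g ⟶ pullback f g :=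
  pullback.lift
    (ofMap { toFun := fun p : (fibreProduct f g).carrier => p.1.1, map_smul' := fun _ _ => rfl })
    (ofMap { toFun := fun p : (fibreProduct f g).carrier => p.1.2, map_smul' := fun _ _ => rfl })
    (hom_ext fun p => p.2)

/-- The canonical map from the chosen pullback to the concrete fibre product. -/
noncomputable def pullbackToFibreProduct : pullback f g ⟶ fibreProduct f g := ofMap
  { toFun := fun z => ⟨(toMap (pullback.fst f g) z, toMap (pullback.snd f g) z), by
      rw [← comp_toMap, ← comp_toMap, pullback.condition]⟩
    map_smul' := fun π z => Subtype.ext (Prod.ext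
      (map_smul (toMap (pullback.fst f g)) π z) (map_smul (toMap (pullback.snd f g)) π z)) }

/-- This composite suffices to show that an element of the chosen pullback is determined by its two
components. -/
theorem pullbackToFibreProduct_comp :
    pullbackToFibreProduct f g ≫ fibreProductToPullback f g = 𝟙 _ := by
  refine pullback.hom_ext ?_ ?_
  · rw [Category.assoc, fibreProductToPullback, pullback.lift_fst, Category.id_comp]; rfl
  · rw [Category.assoc, fibreProductToPullback, pullback.lift_snd, Category.id_comp]; rfl

variable {f g}

/-- The element of the pullback with given components. -/
noncomputable def pullbackMk (x : X.carrier) (y : Y.carrier) (h : toMap f x = toMap g y) :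
    (pullback f g).carrier :=
  toMap (fibreProductToPullback f g) ⟨(x, y), h⟩

@[simp] theorem fst_pullbackMk (x : X.carrier) (y : Y.carrier) (h : toMap f x = toMap g y) :
    toMap (pullback.fst f g) (pullbackMk x y h) = x := by
  exact DFunLike.congr_fun (congrArg toMap (pullback.lift_fst _ _ _))
    (show (fibreProduct f g).carrier from ⟨(x, y), h⟩)

@[simp] theorem snd_pullbackMk (x : X.carrier) (y : Y.carrier) (h : toMap f x = toMap g y) :
    toMap (pullback.snd f g) (pullbackMk x y h) = y := by
  exact DFunLike.congr_fun (congrArg toMap (pullback.lift_snd _ _ _))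
    (show (fibreProduct f g).carrier from ⟨(x, y), h⟩)

theorem pullback_ext {z z' : (pullback f g).carrier}
    (h₁ : toMap (pullback.fst f g) z = toMap (pullback.fst f g) z')
    (h₂ : toMap (pullback.snd f g) z = toMap (pullback.snd f g) z') : z = z' := by
  have key : ∀ z, toMap (fibreProductToPullback f g) (toMap (pullbackToFibreProduct f g) z) = z :=
    fun z => by rw [← comp_toMap, pullbackToFibreProduct_comp]; rfl
  rw [← key z, ← key z']
  exact congrArg _ (Subtype.ext (Prod.ext h₁ h₂))

theorem pullback_condition_apply (z : (pullback f g).carrier) :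
    toMap f (toMap (pullback.fst f g) z) = toMap g (toMap (pullback.snd f g) z) := by
  rw [← comp_toMap, pullback.condition, comp_toMap]

end Pullback

/-- The elements of an object of a slice. -/
abbrev El {V : NominalSet 𝔸} (Y : Over V) : Type u := Y.left.carrier

/-- The structure map of an object of a slice, on elements. -/
def proj {V : NominalSet 𝔸} (Y : Over V) : El Y →[FinPerm 𝔸] V.carrier := Y.hom

/-- A morphism of a slice, on elements. -/
def elMap {V : NominalSet 𝔸} {Y Z : Over V} (f : Y ⟶ Z) : El Y →[FinPerm 𝔸] El Z := f.left

section Slice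

variable {V : NominalSet 𝔸} {X Y Z : Over V}

theorem elMap_comp (f : X ⟶ Y) (g : Y ⟶ Z) (x : El X) :
    elMap (f ≫ g) x = elMap g (elMap f x) := rfl

theorem elMap_id (x : El X) : elMap (𝟙 X) x = x := rfl

@[simp] theorem proj_elMap (f : X ⟶ Y) (x : El X) : proj Y (elMap f x) = proj X x :=
  DFunLike.congr_fun (congrArg toMap (Over.w f)) x

theorem over_hom_ext {f g : X ⟶ Y} (h : ∀ x, elMap f x = elMap g x) : f = g :=
  Over.OverMorphism.ext (hom_ext h)

/-- A morphism of a slice, from its action on elements. -/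
def ofElMap (f : El X →[FinPerm 𝔸] El Y) (hf : ∀ x, proj Y (f x) = proj X x) : X ⟶ Y :=
  Over.homMk (ofMap (X := X.left) (Y := Y.left) f) (hom_ext hf)

end Slice

section Restrict

variable {U V : NominalSet 𝔸} (p : V ⟶ U)

/-- The projection of the restriction of a set to the set itself, on elements. -/
noncomputable def restrictFst (Y : Over U) : El ((Over.pullback p).obj Y) →[FinPerm 𝔸] El Y :=
  toMap (pullback.fst Y.hom p)

theorem proj_restrictFst (Y : Over U) (z : El ((Over.pullback p).obj Y)) :
    proj Y (restrictFst p Y z) = toMap p (proj _ z) :=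
  pullback_condition_apply (f := Y.hom) (g := p) z

theorem restrict_ext {Y : Over U} {z z' : El ((Over.pullback p).obj Y)}
    (h₁ : restrictFst p Y z = restrictFst p Y z') (h₂ : proj _ z = proj _ z') : z = z' :=
  pullback_ext (f := Y.hom) (g := p) h₁ h₂

/-- An element of the restriction of a set. -/
noncomputable def restrictMk {Y : Over U} (y : El Y) (v : V.carrier) (h : proj Y y = toMap p v) :
    El ((Over.pullback p).obj Y) :=
  pullbackMk (f := Y.hom) (g := p) y v h

@[simp] theorem restrictFst_restrictMk {Y : Over U} (y : El Y) (v : V.carrier)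
    (h : proj Y y = toMap p v) : restrictFst p Y (restrictMk p y v h) = y :=
  fst_pullbackMk (f := Y.hom) (g := p) y v h

@[simp] theorem proj_restrictMk {Y : Over U} (y : El Y) (v : V.carrier)
    (h : proj Y y = toMap p v) : proj _ (restrictMk p y v h) = v :=
  snd_pullbackMk (f := Y.hom) (g := p) y v h

theorem restrictFst_map {Y Z : Over U} (f : Y ⟶ Z) (z : El ((Over.pullback p).obj Y)) :
    restrictFst p Z (elMap ((Over.pullback p).map f) z) = elMap f (restrictFst p Y z) := by
  have h : ((Over.pullback p).map f).left ≫ pullback.fst Z.hom p =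
      pullback.fst Y.hom p ≫ f.left := pullback.lift_fst _ _ _
  exact DFunLike.congr_fun (congrArg toMap h) z

end Restrict

/-! ### The fibres of a group of a slice -/

section Fibres

attribute [local instance] Over.cartesianMonoidalCategory Over.braidedCategory
attribute [local instance] Hom.group

variable {V : NominalSet 𝔸}

/-- An element of the product of two sets in a slice. -/
noncomputable def pairMk {Y Z : Over V} (y : El Y) (z : El Z) (h : proj Y y = proj Z z) :
    El (Y ⊗ Z) :=
  pullbackMk (f := Y.hom) (g := Z.hom) y z h

@[simp] theorem fst_pairMk {Y Z : Over V} (y : El Y) (z : El Z) (h : proj Y y = proj Z z) :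
    elMap (fst Y Z) (pairMk y z h) = y :=
  fst_pullbackMk (f := Y.hom) (g := Z.hom) y z h

@[simp] theorem snd_pairMk {Y Z : Over V} (y : El Y) (z : El Z) (h : proj Y y = proj Z z) :
    elMap (snd Y Z) (pairMk y z h) = z :=
  snd_pullbackMk (f := Y.hom) (g := Z.hom) y z h

theorem pair_ext {Y Z : Over V} {z z' : El (Y ⊗ Z)}
    (h₁ : elMap (fst Y Z) z = elMap (fst Y Z) z') (h₂ : elMap (snd Y Z) z = elMap (snd Y Z) z') :
    z = z' :=
  pullback_ext (f := Y.hom) (g := Z.hom) h₁ h₂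

theorem elMap_lift {T Y Z : Over V} (f : T ⟶ Y) (g : T ⟶ Z) (t : El T) :
    elMap (lift f g) t = pairMk (elMap f t) (elMap g t) (by simp) := by
  refine pair_ext ?_ ?_
  · rw [← elMap_comp, lift_fst, fst_pairMk]
  · rw [← elMap_comp, lift_snd, snd_pairMk]

theorem smul_pairMk {Y Z : Over V} (π : FinPerm 𝔸) (y : El Y) (z : El Z)
    (h : proj Y y = proj Z z) (h' : proj Y (π • y) = proj Z (π • z)) :
    π • pairMk y z h = pairMk (π • y) (π • z) h' := by
  refine pair_ext ?_ ?_ <;> simp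

variable (G H : GroupAt V)

/-- The product of two elements in the same fibre of a group. -/
noncomputable def fibreMul (x y : El G.X) (h : proj G.X x = proj G.X y) : El G.X :=
  elMap (MonObj.mul (X := G.X)) (pairMk x y h)

@[simp] theorem proj_fibreMul (x y : El G.X) (h : proj G.X x = proj G.X y) :
    proj G.X (fibreMul G x y h) = proj G.X x := by
  rw [fibreMul, proj_elMap, ← proj_elMap (fst G.X G.X), fst_pairMk]

theorem smul_fibreMul (π : FinPerm 𝔸) (x y : El G.X) (h : proj G.X x = proj G.X y) :
    π • fibreMul G x y h = fibreMul G (π • x) (π • y) (by simp [h]) := by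
  rw [fibreMul, fibreMul, ← map_smul, smul_pairMk _ _ _ h]

theorem elMap_mul {T : Over V} (f g : T ⟶ G.X) (t : El T) :
    elMap (f * g) t = fibreMul G (elMap f t) (elMap g t) (by simp) := by
  rw [Hom.mul_def, elMap_comp, elMap_lift]; rfl

/-- The fibre of a group over a point of the base. -/
@[ext] structure Fibre (v : V.carrier) : Type u where
  /-- The underlying element of the group. -/
  val : El G.X
  property : proj G.X val = v

/-- The terminal object of the slice is `V` over itself, so the unit of a group is a section of its
structure map, with one value over each point. -/
theorem elMap_one {T : Over V} (t : El T) :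
    elMap (1 : T ⟶ G.X) t = elMap (MonObj.one (X := G.X)) (show V.carrier from proj T t) := by
  rw [Hom.one_def]; rfl

/-- The axioms are those of the hom-groups `T ⟶ G.X`, evaluated at elements: associativity for the
three projections of the triple product, the others for the identity of `G.X`. -/
noncomputable instance (v : V.carrier) : Group (Fibre G v) where
  mul x y := ⟨fibreMul G x.1 y.1 (x.2.trans y.2.symm), by rw [proj_fibreMul, x.2]⟩
  one := ⟨elMap (MonObj.one (X := G.X)) v, by rw [proj_elMap]; rfl⟩
  inv x := ⟨elMap (GrpObj.inv (X := G.X)) x.1, by rw [proj_elMap, x.2]⟩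
  mul_assoc x y z := by
    have hxy : proj G.X x.1 = proj G.X y.1 := x.2.trans y.2.symm
    let t : El ((G.X ⊗ G.X) ⊗ G.X) := pairMk (pairMk x.1 y.1 hxy) z.1 (by
      rw [← proj_elMap (fst G.X G.X), fst_pairMk, x.2, z.2])
    have := congrArg (fun f => elMap f t) (mul_assoc (fst (G.X ⊗ G.X) G.X ≫ fst G.X G.X)
      (fst (G.X ⊗ G.X) G.X ≫ snd G.X G.X) (snd (G.X ⊗ G.X) G.X))
    simp only [elMap_mul, elMap_comp, t, fst_pairMk, snd_pairMk] at this
    exact Fibre.ext this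
  one_mul x := by
    have := congrArg (fun f => elMap f x.1) (one_mul (𝟙 G.X))
    simp only [elMap_mul, elMap_one, elMap_id, x.2] at this
    exact Fibre.ext this
  mul_one x := by
    have := congrArg (fun f => elMap f x.1) (mul_one (𝟙 G.X))
    simp only [elMap_mul, elMap_one, elMap_id, x.2] at this
    exact Fibre.ext this
  inv_mul_cancel x := by
    have := congrArg (fun f => elMap f x.1) (inv_mul_cancel (𝟙 G.X))
    simp only [elMap_mul, elMap_one, elMap_id, x.2, Hom.inv_def, Category.id_comp] at this
    exact Fibre.ext this

variable {G H}

theorem Fibre.val_mul {v : V.carrier} (x y : Fibre G v) :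
    (x * y).1 = fibreMul G x.1 y.1 (x.2.trans y.2.symm) := rfl

theorem elMap_mapOf_fibreMul (φ : H ⟶ G) (x y : El H.X) (h : proj H.X x = proj H.X y) :
    elMap (GroupAt.mapOf φ) (fibreMul H x y h) =
      fibreMul G (elMap (GroupAt.mapOf φ) x) (elMap (GroupAt.mapOf φ) y) (by simp [h]) := by
  rw [fibreMul, ← elMap_comp, GroupAt.mapOf, IsMonHom.mul_hom, elMap_comp, fibreMul]
  congr 1
  refine pair_ext ?_ ?_
  · rw [← elMap_comp, tensorHom_fst, elMap_comp, fst_pairMk, fst_pairMk]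
  · rw [← elMap_comp, tensorHom_snd, elMap_comp, snd_pairMk, snd_pairMk]

/-- A homomorphism of groups of a slice, restricted to a fibre. -/
noncomputable def fibreHom (φ : H ⟶ G) (v : V.carrier) : Fibre H v →* Fibre G v :=
  MonoidHom.mk' (fun x => ⟨elMap (GroupAt.mapOf φ) x.1, by rw [proj_elMap, x.2]⟩)
    fun x y => Fibre.ext (elMap_mapOf_fibreMul φ x.1 y.1 _)

theorem groupAt_hom_ext {φ ψ : H ⟶ G}
    (h : ∀ x, elMap (GroupAt.mapOf φ) x = elMap (GroupAt.mapOf ψ) x) : φ = ψ := by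
  ext1; ext1
  exact congrArg Over.Hom.left (over_hom_ext h)

/-- A homomorphism of groups of a slice, from a map that is a homomorphism on every fibre. -/
noncomputable def homOfFibres (f : H.X ⟶ G.X)
    (hf : ∀ x y h, elMap f (fibreMul H x y h) =
      fibreMul G (elMap f x) (elMap f y) (by simp [h])) : H ⟶ G :=
  Grp.homMk'' f
    (by
      refine over_hom_ext fun v => ?_
      -- A multiplicative map between groups preserves the unit, so the unit condition follows fibre
      -- by fibre.
      let F : Fibre H v →* Fibre G v :=
        MonoidHom.mk' (fun x => ⟨elMap f x.1, by rw [proj_elMap, x.2]⟩)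
          fun x y => Fibre.ext (hf x.1 y.1 _)
      exact congrArg Fibre.val (map_one F))
    (by
      refine over_hom_ext fun z => ?_
      have hz : proj H.X (elMap (fst H.X H.X) z) = proj H.X (elMap (snd H.X H.X) z) := by simp
      have e : z = pairMk (elMap (fst H.X H.X) z) (elMap (snd H.X H.X) z) hz := by
        refine pair_ext ?_ ?_ <;> simp
      rw [elMap_comp, elMap_comp]
      have := hf _ _ hz
      rw [fibreMul, ← e] at this
      rw [this, fibreMul]
      congr 1
      refine pair_ext ?_ ?_
      · rw [← elMap_comp _ (fst _ _), tensorHom_fst, elMap_comp, fst_pairMk]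
      · rw [← elMap_comp _ (snd _ _), tensorHom_snd, elMap_comp, snd_pairMk])

/-- The action of a permutation on the fibres of a group. -/
noncomputable def fibreSmul (π : FinPerm 𝔸) (v : V.carrier) : Fibre G v →* Fibre G (π • v) :=
  MonoidHom.mk' (fun x => ⟨π • x.1, by rw [map_smul, x.2]⟩)
    fun x y => Fibre.ext (smul_fibreMul G π x.1 y.1 _)

/-- The multiplication of a restricted group is the pullback of the multiplication, preceded by the
comparison map `μ`; since `μ` respects both projections, it does not change the factors. -/
theorem restrictFst_fibreMul {U : NominalSet 𝔸} (p : V ⟶ U) (G : GroupAt U)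
    (x y : El ((GroupAt.restrict p).obj G).X) (h) :
    restrictFst p G.X (fibreMul ((GroupAt.restrict p).obj G) x y h) =
      fibreMul G (restrictFst p G.X x) (restrictFst p G.X y)
        ((proj_restrictFst p G.X x).trans ((congrArg (toMap p) h).trans (proj_restrictFst p G.X y).symm)) := by
  let P := Over.pullback p
  let z : El (P.obj G.X ⊗ P.obj G.X) := pairMk (Y := P.obj G.X) (Z := P.obj G.X) x y h
  let w : El (P.obj (G.X ⊗ G.X)) := elMap (Functor.LaxMonoidal.μ P G.X G.X) z
  have h₁ : elMap (P.map (fst G.X G.X)) w = x := by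
    rw [← elMap_comp, Functor.Monoidal.μ_fst]
    exact fst_pairMk (Y := P.obj G.X) (Z := P.obj G.X) x y h
  have h₂ : elMap (P.map (snd G.X G.X)) w = y := by
    rw [← elMap_comp, Functor.Monoidal.μ_snd]
    exact snd_pairMk (Y := P.obj G.X) (Z := P.obj G.X) x y h
  refine (restrictFst_map p (MonObj.mul (X := G.X)) w).trans (congrArg (elMap _) (pair_ext ?_ ?_))
  · rw [fst_pairMk, ← restrictFst_map]
    exact congrArg (restrictFst p G.X) h₁
  · rw [snd_pairMk, ← restrictFst_map]
    exact congrArg (restrictFst p G.X) h₂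

theorem fibreMul_groupOverOne (G : Type u) [Group G] [MulDistribMulAction (FinPerm 𝔸) G]
    (hG : ∀ x : G, FinitelySupported 𝔸 x) (x y : G) (h) :
    fibreMul (groupOverOne G hG) x y h = x * y := by
  refine (groupOverOne_mul_apply G hG _).trans (congrArg₂ (fun a b : G => a * b) ?_ ?_)
  · exact fst_pairMk (Y := (groupOverOne G hG).X) (Z := (groupOverOne G hG).X) x y h
  · exact snd_pairMk (Y := (groupOverOne G hG).X) (Z := (groupOverOne G hG).X) x y h

end Fibres

end NominalSet

/-! ### The parity of an element of the subgroup generated by commutators of letters -/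

section Parity

variable {𝔸 : Type u}

/-- The commutator of two letters, as an element of the subgroup generated by them. -/
def letterCommutator (a b : 𝔸) : commutatorSubgroupOfLetters 𝔸 :=
  ⟨FreeGroup.of a * FreeGroup.of b * (FreeGroup.of a)⁻¹ * (FreeGroup.of b)⁻¹,
    Subgroup.subset_closure ⟨a, b, rfl⟩⟩

theorem smul_letterCommutator (π : FinPerm 𝔸) (a b : 𝔸) :
    π • letterCommutator a b = letterCommutator (π • a) (π • b) := by
  refine Subtype.ext ?_
  change π • (FreeGroup.of a * FreeGroup.of b * (FreeGroup.of a)⁻¹ * (FreeGroup.of b)⁻¹) = _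
  simp only [smul_mul', smul_inv', FreeGroup.finPerm_smul_of]
  rfl

theorem inv_letterCommutator (a b : 𝔸) : (letterCommutator a b)⁻¹ = letterCommutator b a := by
  refine Subtype.ext ?_
  simp [letterCommutator, mul_assoc]

theorem letterCommutator_self (a : 𝔸) : letterCommutator a a = 1 := by
  refine Subtype.ext ?_
  simp [letterCommutator]

/-- The action of a letter in the representation of a Heisenberg group over `ℤ/2` attached to the
bilinear form with matrix `B`. A state `(u, z)` records a linear functional `u` by its values on
letters, and a central coordinate `z`. -/
def heisenbergLetter (B : 𝔸 → 𝔸 → ZMod 2) (a : 𝔸) : Equiv.Perm ((𝔸 → ZMod 2) × ZMod 2) where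
  toFun p := (fun c => p.1 c + B c a, p.2 + p.1 a)
  invFun p := (fun c => p.1 c - B c a, p.2 - (p.1 a - B a a))
  left_inv p := by ext <;> simp
  right_inv p := by ext <;> simp

/-- The two orders of applying a and b shift the functional equally, but the second letter also sees
the shift made by the first; this leaves the antisymmetrisation of `B` in the central coordinate. -/
theorem heisenbergLetter_commutator (B : 𝔸 → 𝔸 → ZMod 2) (a b : 𝔸)
    (p : (𝔸 → ZMod 2) × ZMod 2) :
    FreeGroup.lift (heisenbergLetter B) (letterCommutator a b : FreeGroup 𝔸) p =
      (p.1, p.2 + (B a b - B b a)) := by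
  -- Since [a,b]·ba = ab, on states of the form ba·q no inverse of a letter has to be computed.
  obtain ⟨q, rfl⟩ := (heisenbergLetter B b * heisenbergLetter B a).surjective p
  have : FreeGroup.lift (heisenbergLetter B) (letterCommutator a b : FreeGroup 𝔸) *
      (heisenbergLetter B b * heisenbergLetter B a) =
      heisenbergLetter B a * heisenbergLetter B b := by
    simp [letterCommutator, mul_assoc]
  rw [← Equiv.Perm.mul_apply, this]
  simp only [heisenbergLetter, Equiv.Perm.mul_apply, Equiv.coe_fn_mk, Prod.mk.injEq]
  exact ⟨funext fun c => by ring, by ring⟩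

/-- Translations of the central coordinate form a group and contain the images of the generators of
C. -/
theorem exists_central_translation (B : 𝔸 → 𝔸 → ZMod 2) {x : FreeGroup 𝔸}
    (hx : x ∈ commutatorSubgroupOfLetters 𝔸) :
    ∃ k : ZMod 2, ∀ p, FreeGroup.lift (heisenbergLetter B) x p = (p.1, p.2 + k) := by
  induction hx using Subgroup.closure_induction with
  | mem x hx =>
    obtain ⟨a, b, rfl⟩ := hx
    exact ⟨_, heisenbergLetter_commutator B a b⟩
  | one => exact ⟨0, fun p => by simp⟩
  | mul x y _ _ hx hy =>
    obtain ⟨k, hk⟩ := hx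
    obtain ⟨l, hl⟩ := hy
    refine ⟨l + k, fun p => ?_⟩
    rw [map_mul, Equiv.Perm.mul_apply, hl, hk]
    simp only [add_assoc]
  | inv x _ hx =>
    obtain ⟨k, hk⟩ := hx
    refine ⟨-k, fun p => ?_⟩
    rw [map_inv, Equiv.Perm.inv_eq_iff_eq, hk]
    simp only [add_assoc, neg_add_cancel, add_zero]

/-- There is a homomorphism to `ℤ/2` that sends every commutator of two different letters to the
generator. -/
theorem exists_commutatorParity (𝔸 : Type u) :
    ∃ χ : commutatorSubgroupOfLetters 𝔸 →* Multiplicative (ZMod 2),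
      ∀ a b : 𝔸, a ≠ b → χ (letterCommutator a b) = Multiplicative.ofAdd 1 := by
  classical
  -- For a strict linear order, B a b − B b a = ±1 when a ≠ b. The sign depends on the order, but it
  -- vanishes modulo 2.
  let B : 𝔸 → 𝔸 → ZMod 2 := fun a b => if WellOrderingRel a b then 1 else 0
  choose k hk using fun x : commutatorSubgroupOfLetters 𝔸 => exists_central_translation B x.2
  refine ⟨MonoidHom.mk' (fun x => Multiplicative.ofAdd (k x)) fun x y => ?_, fun a b hab => ?_⟩
  · have h := hk (x * y) 0
    rw [Subgroup.coe_mul, map_mul, Equiv.Perm.mul_apply, hk, hk] at h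
    have h' := congrArg Prod.snd h
    simp only [Prod.snd_zero, zero_add] at h'
    rw [← h', add_comm, ofAdd_add]
  · have h := hk (letterCommutator a b) 0
    rw [heisenbergLetter_commutator] at h
    have h' := congrArg Prod.snd h
    simp only [Prod.snd_zero, zero_add] at h'
    change Multiplicative.ofAdd (k _) = _
    rw [← h']
    refine congrArg Multiplicative.ofAdd ?_
    rcases trichotomous_of WellOrderingRel a b with h | h | h
    · simp [B, h, asymm_of WellOrderingRel h]
    · exact absurd h hab
    · simp only [B, h, asymm_of WellOrderingRel h]; decide

/-- The value of χ on a generator [a,b] depends only on whether a = b, which permutations preserve,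
even though the order used to construct χ is not invariant. -/
theorem commutatorParity_smul {χ : commutatorSubgroupOfLetters 𝔸 →* Multiplicative (ZMod 2)}
    (hχ : ∀ a b : 𝔸, a ≠ b → χ (letterCommutator a b) = Multiplicative.ofAdd 1)
    (π : FinPerm 𝔸) (x : commutatorSubgroupOfLetters 𝔸) : χ (π • x) = χ x := by
  obtain ⟨x, hx⟩ := x
  induction hx using Subgroup.closure_induction with
  | mem x hx =>
    obtain ⟨a, b, rfl⟩ := hx
    change χ (π • letterCommutator a b) = χ (letterCommutator a b)
    rw [smul_letterCommutator]
    by_cases hab : a = b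
    · rw [hab, letterCommutator_self, letterCommutator_self]
    · rw [hχ _ _ hab, hχ _ _ fun h => hab (MulAction.injective π h)]
  | one =>
    change χ (π • (1 : commutatorSubgroupOfLetters 𝔸)) = χ 1
    rw [smul_one]
  | mul x y hx hy ihx ihy =>
    change χ (π • ((⟨x, hx⟩ : commutatorSubgroupOfLetters 𝔸) * ⟨y, hy⟩)) =
      χ ((⟨x, hx⟩ : commutatorSubgroupOfLetters 𝔸) * ⟨y, hy⟩)
    rw [smul_mul', map_mul, map_mul, ihx, ihy]
  | inv x hx ih =>
    change χ (π • (⟨x, hx⟩ : commutatorSubgroupOfLetters 𝔸)⁻¹) =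
      χ (⟨x, hx⟩ : commutatorSubgroupOfLetters 𝔸)⁻¹
    rw [smul_inv', map_inv, map_inv, ih]

/-! ### The obstruction in ℤ/4 and the external statement -/

/-- Reduction `ℤ/4 → ℤ/2`, written multiplicatively. -/
def reduceMod2 : Multiplicative (ZMod 4) →* Multiplicative (ZMod 2) :=
  AddMonoidHom.toMultiplicative (ZMod.castHom (by norm_num : 2 ∣ 4) (ZMod 2)).toAddMonoidHom

/-- A section of the reduction `ℤ/4 → ℤ/2`; it is not a homomorphism. -/
def liftMod4 (z : Multiplicative (ZMod 2)) : Multiplicative (ZMod 4) :=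
  Multiplicative.ofAdd ((Multiplicative.toAdd z).val : ZMod 4)

theorem reduceMod2_liftMod4 : ∀ z, reduceMod2 (liftMod4 z) = z := by
  unfold reduceMod2 liftMod4; decide

theorem reduceMod2_of_mul_self : ∀ m, m * m = 1 → reduceMod2 m ≠ Multiplicative.ofAdd 1 := by
  unfold reduceMod2; decide

/-- The transposition of two atoms. -/
def atomSwap [DecidableEq 𝔸] (a b : 𝔸) : FinPerm 𝔸 :=
  ⟨Equiv.swap a b, ((Set.finite_singleton b).insert a).subset fun c hc => by
    by_contra h
    simp only [Set.mem_insert_iff, Set.mem_singleton_iff, not_or] at h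
    exact hc (Equiv.swap_apply_of_ne_of_ne h.1 h.2)⟩

theorem atomSwap_smul_letterCommutator [DecidableEq 𝔸] (a b : 𝔸) :
    atomSwap a b • letterCommutator a b = (letterCommutator a b)⁻¹ := by
  rw [smul_letterCommutator, inv_letterCommutator]
  exact congrArg₂ _ (Equiv.swap_apply_left a b) (Equiv.swap_apply_right a b)

/-- A finitely supported element is fixed by the transposition of two suitable atoms. -/
theorem FinitelySupported.exists_swap_smul_eq [Infinite 𝔸] [DecidableEq 𝔸] {X : Type v}
    [SMul (FinPerm 𝔸) X] {x : X} (hx : FinitelySupported 𝔸 x) :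
    ∃ a b : 𝔸, a ≠ b ∧ atomSwap a b • x = x := by
  obtain ⟨S, hS, h⟩ := hx
  obtain ⟨a, ha⟩ := hS.exists_notMem
  obtain ⟨b, hb⟩ := (hS.insert a).exists_notMem
  rw [Set.mem_insert_iff, not_or] at hb
  refine ⟨a, b, Ne.symm hb.1, h _ fun c hc => ?_⟩
  exact Equiv.swap_apply_of_ne_of_ne (fun h => ha (h ▸ hc)) (fun h => hb.2 (h ▸ hc))

/-- A basis would let χ lift to a swap-invariant homomorphism into ℤ/4, whose value on [a,b] would
have to be both odd and of order at most two. -/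
theorem not_freelyGenerates_commutatorSubgroupOfLetters [Infinite 𝔸] (X : Set (FreeGroup 𝔸))
    (hX : FinitelySupported 𝔸 X) : ¬ FreelyGenerates X (commutatorSubgroupOfLetters 𝔸) := by
  classical
  rintro ⟨hXC, hbij⟩
  obtain ⟨χ, hχ⟩ := exists_commutatorParity 𝔸
  obtain ⟨a, b, hab, hfix⟩ := hX.exists_swap_smul_eq
  let C := commutatorSubgroupOfLetters 𝔸
  let e : FreeGroup X ≃* C := MulEquiv.ofBijective _ hbij
  have he : ∀ x : X, e (FreeGroup.of x) = ⟨x, hXC x.2⟩ := fun x =>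
    (FreeGroup.lift_apply_of : FreeGroup.lift (fun x : X => (⟨x, hXC x.2⟩ : C)) (.of x) = _)
  let f : C →* Multiplicative (ZMod 4) :=
    (FreeGroup.lift fun x : X => liftMod4 (χ ⟨x, hXC x.2⟩)).comp e.symm.toMonoidHom
  have hf : ∀ x : X, f ⟨x, hXC x.2⟩ = liftMod4 (χ ⟨x, hXC x.2⟩) := fun x => by
    rw [← he x]
    simp only [f, MonoidHom.comp_apply, MulEquiv.toMonoidHom_eq_coe, MonoidHom.coe_coe,
      MulEquiv.symm_apply_apply, FreeGroup.lift_apply_of]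
    rw [he x]
  have ext : ∀ {M : Type} [Group M] {g h : C →* M},
      (∀ x : X, g ⟨x, hXC x.2⟩ = h ⟨x, hXC x.2⟩) → g = h := fun {M} _ {g h} H => by
    have : g.comp e.toMonoidHom = h.comp e.toMonoidHom := FreeGroup.ext_hom _ _ fun x => by
      simpa only [MonoidHom.comp_apply, MulEquiv.toMonoidHom_eq_coe, MonoidHom.coe_coe, he]
        using H x
    ext1 c
    simpa using DFunLike.congr_fun this (e.symm c)
  have hred : reduceMod2.comp f = χ := ext fun x => by
    rw [MonoidHom.comp_apply, hf, reduceMod2_liftMod4]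
  -- The swap fixes `X` as a set, not pointwise. This is enough, because on `X` the value of `f`
  -- depends only on that of χ.
  have hinv : f.comp (MulDistribMulAction.toMonoidHom C (atomSwap a b)) = f := ext fun x => by
    have hx : atomSwap a b • (x : FreeGroup 𝔸) ∈ X :=
      hfix.subset (Set.smul_mem_smul_set x.2)
    refine (hf ⟨_, hx⟩).trans ?_
    rw [hf]
    exact congrArg liftMod4 (commutatorParity_smul hχ (atomSwap a b) ⟨x, hXC x.2⟩)
  have h := DFunLike.congr_fun hinv (letterCommutator a b)
  rw [MonoidHom.comp_apply, MulDistribMulAction.toMonoidHom_apply,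
    atomSwap_smul_letterCommutator, map_inv, inv_eq_iff_mul_eq_one] at h
  refine reduceMod2_of_mul_self _ h ?_
  rw [← hχ a b hab, ← hred]
  rfl

end Parity

/-! ### Free groups, fibrewise and internally -/

/-- The universal property of a free group, for the map `i`. -/
def IsFreeBasis {T H : Type u} [Group H] (i : T → H) : Prop :=
  ∀ (K : Type u) [Group K] (g : T → K), ∃! φ : H →* K, ∀ t, φ (i t) = g t

theorem IsFreeBasis.hom_ext {T H K : Type u} [Group H] [Group K] {i : T → H} (hi : IsFreeBasis i)
    {φ ψ : H →* K} (h : ∀ t, φ (i t) = ψ (i t)) : φ = ψ :=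
  (hi K fun t => ψ (i t)).unique h fun _ => rfl

theorem IsFreeBasis.of_equiv {T H T' H' : Type u} [Group H] [Group H'] {i : T → H} {i' : T' → H'}
    (hi : IsFreeBasis i) (e : H' ≃* H) (e' : T' ≃ T) (h : ∀ t, e (i' t) = i (e' t)) :
    IsFreeBasis i' := by
  intro K _ g
  obtain ⟨φ, hφ, huniq⟩ := hi K (g ∘ e'.symm)
  refine ⟨φ.comp e.toMonoidHom, fun t => ?_, fun ψ hψ => ?_⟩
  · simp [h, hφ]
  · have : ψ.comp e.symm.toMonoidHom = φ := huniq _ fun t => by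
      have := h (e'.symm t)
      rw [Equiv.apply_symm_apply] at this
      simp [← this, hψ]
    rw [← this]
    ext
    simp

theorem FreeGroup.isFreeBasis_of (T : Type u) : IsFreeBasis (FreeGroup.of : T → FreeGroup T) :=
  fun _ _ g => ⟨FreeGroup.lift g, fun _ => FreeGroup.lift_apply_of, fun ψ hψ =>
    FreeGroup.ext_hom _ _ fun t => by rw [hψ, FreeGroup.lift_apply_of]⟩

namespace NominalSet

open InternalLogic

attribute [local instance] Over.cartesianMonoidalCategory Over.braidedCategory

variable {𝔸 : Type u} {U V : NominalSet 𝔸}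

/-- The map from the fibre of a set over `v` to the fibre of a group. -/
noncomputable def fibreMap {H : GroupAt V} {X : Over V} (i : X ⟶ H.X) (v : V.carrier)
    (x : {x : El X // proj X x = v}) : Fibre H v :=
  ⟨elMap i x.1, (proj_elMap i x.1).trans x.2⟩

/-- Every fibre of `H` is free on the corresponding fibre of `X`. -/
def FibrewiseFree (H : GroupAt V) {X : Over V} (i : X ⟶ H.X) : Prop :=
  ∀ v, IsFreeBasis (fibreMap i v)

/-- The fibres of the restriction of a group are fibres of the group. -/
noncomputable def fibreRestrict (p : V ⟶ U) (H : GroupAt U) (v : V.carrier) :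
    Fibre ((GroupAt.restrict p).obj H) v ≃* Fibre H (toMap p v) where
  toFun x := ⟨restrictFst p H.X x.val,
    (proj_restrictFst p H.X x.val).trans (congrArg (toMap p) x.property)⟩
  invFun y := ⟨restrictMk p y.val v y.property, proj_restrictMk p _ _ _⟩
  left_inv x := Fibre.ext (restrict_ext p (restrictFst_restrictMk p _ _ _)
    ((proj_restrictMk p _ _ _).trans x.property.symm))
  right_inv _ := Fibre.ext (restrictFst_restrictMk p _ _ _)
  map_mul' x y := Fibre.ext (restrictFst_fibreMul p H x.val y.val _)

/-- The fibres of the restriction of a set are fibres of the set. -/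
noncomputable def fibreRestrictSet (p : V ⟶ U) (X : Over U) (v : V.carrier) :
    {x : El ((Over.pullback p).obj X) // proj _ x = v} ≃ {x : El X // proj X x = toMap p v} where
  toFun x := ⟨restrictFst p X x.1, (proj_restrictFst p X x.1).trans (congrArg (toMap p) x.2)⟩
  invFun y := ⟨restrictMk p y.1 v y.2, proj_restrictMk p y.1 v y.2⟩
  left_inv x := Subtype.ext (restrict_ext p (restrictFst_restrictMk p _ _ _)
    ((proj_restrictMk p _ _ _).trans x.2.symm))
  right_inv _ := Subtype.ext (restrictFst_restrictMk p _ _ _)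

theorem FibrewiseFree.restrict {H : GroupAt U} {X : Over U} {i : X ⟶ H.X}
    (hi : FibrewiseFree H i) (p : V ⟶ U) :
    FibrewiseFree ((GroupAt.restrict p).obj H) ((Over.pullback p).map i) := fun v =>
  (hi (toMap p v)).of_equiv (fibreRestrict p H v) (fibreRestrictSet p X v) fun x =>
    Fibre.ext (restrictFst_map p i x.1)

/-- Freeness of the fibres gives existence and uniqueness over each point; uniqueness also makes the
family equivariant. -/
theorem FibrewiseFree.existsUnique_hom {H : GroupAt V} {X : Over V} {i : X ⟶ H.X}
    (hi : FibrewiseFree H i) (G : GroupAt V) (g : X ⟶ G.X) :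
    ∃! φ : H ⟶ G, i ≫ GroupAt.mapOf φ = g := by
  choose Φ hΦ _ using fun v => hi v (Fibre G v) (fibreMap g v)
  let f : El H.X → El G.X := fun x => (Φ (proj H.X x) ⟨x, rfl⟩).val
  have hf : ∀ v (x : Fibre H v), f x.val = (Φ v x).val := by
    rintro _ ⟨x, rfl⟩
    rfl
  have hsmul : ∀ (π : FinPerm 𝔸) (x : El H.X), f (π • x) = π • f x := fun π x => by
    -- Both sides are homomorphisms from the fibre over v to the fibre over π • v, so it is enough
    -- to compare them on the basis.
    have : (Φ (π • proj H.X x)).comp (fibreSmul π _) = (fibreSmul π _).comp (Φ (proj H.X x)) :=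
      (hi _).hom_ext fun t => by
        have e : fibreSmul π _ (fibreMap i _ t) =
            fibreMap i (π • proj H.X x) ⟨π • t.1, by rw [map_smul, t.2]⟩ :=
          Fibre.ext (map_smul (elMap i) π t.1).symm
        rw [MonoidHom.comp_apply, MonoidHom.comp_apply, e, hΦ, hΦ]
        exact Fibre.ext (map_smul (elMap g) π t.1)
    exact (hf _ (fibreSmul π _ ⟨x, rfl⟩)).trans
      (congrArg Fibre.val (DFunLike.congr_fun this ⟨x, rfl⟩))
  let F : H.X ⟶ G.X := ofElMap { toFun := f, map_smul' := hsmul } fun x => (Φ _ ⟨x, rfl⟩).property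
  have hF : ∀ v (x : Fibre H v), elMap F x.val = (Φ v x).val := hf
  refine ⟨homOfFibres F fun x y h => ?_, over_hom_ext fun x => ?_, fun ψ hψ =>
    groupAt_hom_ext fun x => ?_⟩
  · have := congrArg Fibre.val (map_mul (Φ (proj H.X x)) ⟨x, rfl⟩ ⟨y, h.symm⟩)
    refine (hF _ ((⟨x, rfl⟩ : Fibre H (proj H.X x)) * ⟨y, h.symm⟩)).trans (this.trans ?_)
    rw [Fibre.val_mul]
    congr 1
    exact (hF _ ⟨y, h.symm⟩).symm
  · have := hF _ (fibreMap i (proj X x) ⟨x, rfl⟩)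
    rw [hΦ] at this
    exact this
  · have : fibreHom ψ (proj H.X x) = Φ (proj H.X x) := (hi _).hom_ext fun t => by
      rw [hΦ]
      exact Fibre.ext (DFunLike.congr_fun (congrArg elMap hψ) t.1)
    exact (congrArg Fibre.val (DFunLike.congr_fun this ⟨x, rfl⟩)).trans (hF _ ⟨x, rfl⟩).symm

theorem FibrewiseFree.forcesFreelyGenerates {H : GroupAt V} {X : Over V} {i : X ⟶ H.X}
    (hi : FibrewiseFree H i) : ForcesFreelyGenerates H i :=
  fun _ p G g => (hi.restrict p).existsUnique_hom G g

/-- The base has a single point, and the fibre over it is the whole of `FreeGroup 𝔸`. -/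
theorem fibrewiseFree_letters (𝔸 : Type u) : FibrewiseFree (freeGroup 𝔸) (letters 𝔸) := fun _ =>
  (FreeGroup.isFreeBasis_of 𝔸).of_equiv
    { toFun := fun x => (x.val : FreeGroup 𝔸)
      invFun := fun x : FreeGroup 𝔸 => ⟨x, rfl⟩
      left_inv := fun _ => rfl
      right_inv := fun _ => rfl
      map_mul' := fun x y => fibreMul_groupOverOne (FreeGroup 𝔸) _ x.val y.val _ }
    { toFun := fun x => x.1
      invFun := fun a => ⟨a, rfl⟩
      left_inv := fun _ => rfl
      right_inv := fun _ => rfl }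
    fun _ => rfl

/-! ### Groups with the trivial action -/

/-- A group, with the trivial action of `Perm(𝔸)`. -/
def ConstGroup (_ : Type u) (M : Type) : Type u := ULift.{u} M

namespace ConstGroup

variable {M : Type}

/-- An element of `M`, as an element of the group with trivial action. -/
def up (m : M) : ConstGroup 𝔸 M := ULift.up m

/-- The element of `M` underlying an element of the group with trivial action. -/
def down (m : ConstGroup 𝔸 M) : M := ULift.down m

instance [Group M] : Group (ConstGroup 𝔸 M) := inferInstanceAs (Group (ULift.{u} M))

instance [Group M] : MulDistribMulAction (FinPerm 𝔸) (ConstGroup 𝔸 M) where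
  smul _ x := x
  one_smul _ := rfl
  mul_smul _ _ _ := rfl
  smul_mul _ _ _ := rfl
  smul_one _ := rfl

theorem finitelySupported [Group M] (x : ConstGroup 𝔸 M) : FinitelySupported 𝔸 x :=
  ⟨∅, Set.finite_empty, fun _ _ => rfl⟩

end ConstGroup

/-- A group, as a group of the internal language. -/
noncomputable def constGroup (𝔸 : Type u) (M : Type) [Group M] : GroupAt (one 𝔸) :=
  groupOverOne (ConstGroup 𝔸 M) ConstGroup.finitelySupported

/-- Invariant homomorphisms to `M` are homomorphisms to `M` in the internal language. -/
noncomputable def toConstGroup {G : Type u} [Group G] [MulDistribMulAction (FinPerm 𝔸) G]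
    (hG : ∀ x : G, FinitelySupported 𝔸 x) {M : Type} [Group M] (χ : G →* M)
    (hχ : ∀ (π : FinPerm 𝔸) x, χ (π • x) = χ x) : groupOverOne G hG ⟶ constGroup 𝔸 M :=
  groupOverOneMap _ _
    { toFun := fun x => ConstGroup.up (χ x)
      map_smul' := fun π x => congrArg ConstGroup.up (hχ π x)
      map_one' := congrArg ConstGroup.up (map_one χ)
      map_mul' := fun x y => congrArg ConstGroup.up (map_mul χ x y) }

/-- A homomorphism, as a homomorphism in the internal language. -/
noncomputable def constGroupMap {M N : Type} [Group M] [Group N] (χ : M →* N) :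
    constGroup 𝔸 M ⟶ constGroup 𝔸 N :=
  toConstGroup _ (MonoidHom.mk' (fun x : ConstGroup 𝔸 M => χ x.down) fun x y =>
    map_mul χ x.down y.down) fun _ _ => rfl

/-- A map of sets between groups with trivial action, in the internal language. -/
noncomputable def constSetMap {M N : Type} [Group M] [Group N] (s : M → N) :
    (constGroup 𝔸 M).X ⟶ (constGroup 𝔸 N).X :=
  overOneMap (X := ofGroup (ConstGroup 𝔸 M) ConstGroup.finitelySupported)
    (Y := ofGroup (ConstGroup 𝔸 N) ConstGroup.finitelySupported) (ofMap
      { toFun := fun x : ConstGroup 𝔸 M => (ConstGroup.up (s x.down) : ConstGroup 𝔸 N)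
        map_smul' := fun _ _ => rfl })

theorem constSetMap_comp {M N : Type} [Group M] [Group N] (s : M → N) (r : N →* M)
    (h : ∀ m, r (s m) = m) :
    constSetMap (𝔸 := 𝔸) s ≫ GroupAt.mapOf (constGroupMap r) = 𝟙 _ :=
  over_hom_ext fun x => congrArg (ConstGroup.up (𝔸 := 𝔸)) (h (ConstGroup.down x))

/-! ### The internal statement -/

section Coordinates

variable {W W' : NominalSet 𝔸} (f : V ⟶ one 𝔸) (q : W ⟶ V) (p : W' ⟶ W)

/-- Restriction of sets from the terminal stage in three steps. -/
noncomputable abbrev restrictSet₃ : Over (one 𝔸) ⥤ Over W' :=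
  Over.pullback f ⋙ Over.pullback q ⋙ Over.pullback p

/-- Restriction of groups from the terminal stage in three steps. -/
noncomputable abbrev restrict₃ : GroupAt (one 𝔸) ⥤ GroupAt W' :=
  GroupAt.restrict f ⋙ GroupAt.restrict q ⋙ GroupAt.restrict p

/-- The projection of a restriction to the terminal stage, on elements. -/
noncomputable def coord (Y : Over (one 𝔸)) : El ((restrictSet₃ f q p).obj Y) →[FinPerm 𝔸] El Y :=
  (restrictFst f Y).comp ((restrictFst q _).comp (restrictFst p _))

theorem coord_map {Y Z : Over (one 𝔸)} (g : Y ⟶ Z) (z : El ((restrictSet₃ f q p).obj Y)) :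
    coord f q p Z (elMap ((restrictSet₃ f q p).map g) z) = elMap g (coord f q p Y z) := by
  refine (congrArg (fun z => restrictFst f _ (restrictFst q _ z)) (restrictFst_map p _ z)).trans ?_
  refine (congrArg (restrictFst f _) (restrictFst_map q _ _)).trans ?_
  exact restrictFst_map f _ _

theorem coord_fibreMul (G : GroupAt (one 𝔸)) (x y : El ((restrict₃ f q p).obj G).X) (h) :
    coord f q p G.X (fibreMul ((restrict₃ f q p).obj G) x y h) =
      fibreMul G (coord f q p G.X x) (coord f q p G.X y) rfl := by
  refine (congrArg (fun z => restrictFst f _ (restrictFst q _ z))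
    (restrictFst_fibreMul p _ x y h)).trans ?_
  refine (congrArg (restrictFst f _)
    (restrictFst_fibreMul q ((GroupAt.restrict f).obj G) _ _ _)).trans ?_
  exact restrictFst_fibreMul f _ _ _ _

/-- Over a terminal base the restriction of `Y` is the product of `Y` with the stage; `coord` and
`proj` are the two components. -/
theorem coord_ext {Y : Over (one 𝔸)} {z z' : El ((restrictSet₃ f q p).obj Y)}
    (h₁ : coord f q p Y z = coord f q p Y z') (h₂ : proj _ z = proj _ z') : z = z' := by
  have h₃ : proj _ (restrictFst p _ z) = proj _ (restrictFst p _ z') :=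
    (proj_restrictFst p _ z).trans ((congrArg (toMap p) h₂).trans (proj_restrictFst p _ z').symm)
  refine restrict_ext p (restrict_ext q (restrict_ext f h₁ ?_) h₃) h₂
  exact (proj_restrictFst q _ _).trans
    ((congrArg (toMap q) h₃).trans (proj_restrictFst q _ _).symm)

theorem exists_coord_eq {Y : Over (one 𝔸)} (y : El Y) (w : W'.carrier) :
    ∃ z : El ((restrictSet₃ f q p).obj Y), coord f q p Y z = y ∧ proj _ z = w := by
  let z₁ : El ((Over.pullback f).obj Y) := restrictMk f y (toMap q (toMap p w)) rfl
  let z₂ : El ((Over.pullback q).obj ((Over.pullback f).obj Y)) :=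
    restrictMk q z₁ (toMap p w) (proj_restrictMk f _ _ _)
  refine ⟨restrictMk p z₂ w (proj_restrictMk q _ _ _), ?_, proj_restrictMk p _ _ _⟩
  refine (congrArg (fun z => restrictFst f _ (restrictFst q _ z))
    (restrictFst_restrictMk p _ _ _)).trans ?_
  exact (congrArg (restrictFst f _) (restrictFst_restrictMk q _ _ _)).trans
    (restrictFst_restrictMk f _ _ _)

theorem coord_fibreMul_groupOverOne {G : Type u} [Group G] [MulDistribMulAction (FinPerm 𝔸) G]
    {hG : ∀ x : G, FinitelySupported 𝔸 x} {x y : El ((restrict₃ f q p).obj (groupOverOne G hG)).X}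
    {g g' : G} (hx : coord f q p (groupOverOne G hG).X x = g)
    (hy : coord f q p (groupOverOne G hG).X y = g') (h) :
    coord f q p (groupOverOne G hG).X (fibreMul ((restrict₃ f q p).obj (groupOverOne G hG)) x y h) =
      g * g' := by
  refine (coord_fibreMul f q p _ x y h).trans ?_
  refine (fibreMul_groupOverOne G hG _ _ _).trans ?_
  exact congrArg₂ (fun a b : G => a * b) hx hy

/-- A homomorphism to a group with trivial action takes an element that is inverted by a
permutation fixing its stage to an element of order at most two. -/
theorem mul_self_of_smul_eq_inv {G : Type u} [Group G] [MulDistribMulAction (FinPerm 𝔸) G]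
    {hG : ∀ x : G, FinitelySupported 𝔸 x} {M : Type} [Group M]
    (φ : (restrict₃ f q p).obj (groupOverOne G hG) ⟶ (restrict₃ f q p).obj (constGroup 𝔸 M))
    (π : FinPerm 𝔸) (z : El ((restrict₃ f q p).obj (groupOverOne G hG)).X) {g : G}
    (hz : coord f q p (groupOverOne G hG).X z = g) (hg : π • g = g⁻¹)
    (hπ : π • proj _ z = proj _ z) {m : M}
    (hm : coord f q p (constGroup 𝔸 M).X (elMap (GroupAt.mapOf φ) z) =
      (ConstGroup.up m : ConstGroup 𝔸 M)) :
    m * m = 1 := by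
  let H := (restrict₃ f q p).obj (groupOverOne G hG)
  have hz' : coord f q p (groupOverOne G hG).X (π • z) = g⁻¹ :=
    (map_smul (coord f q p _) π z).trans ((congrArg (π • ·) hz).trans hg)
  have h₁ : proj H.X z = proj H.X (π • z) := ((map_smul (proj _) π z).trans hπ).symm
  have h₂ : proj H.X (fibreMul H z (π • z) h₁) = proj H.X z := proj_fibreMul H _ _ _
  -- The relation z · πz · z = z replaces z · πz = 1, so that the unit of the restricted group is
  -- not needed.
  have hcancel : fibreMul H (fibreMul H z (π • z) h₁) z h₂ = z := by
    refine coord_ext f q p ?_ ((proj_fibreMul H _ _ _).trans h₂)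
    refine (coord_fibreMul_groupOverOne f q p
      (coord_fibreMul_groupOverOne f q p hz hz' h₁) hz h₂).trans ?_
    rw [mul_inv_cancel, one_mul]
    exact hz.symm
  -- Equivariance of `φ` and triviality of the action give πz the same value m; the relation then
  -- reads m · m · m = m.
  have hm' : coord f q p (constGroup 𝔸 M).X (elMap (GroupAt.mapOf φ) (π • z)) =
      (ConstGroup.up m : ConstGroup 𝔸 M) :=
    (congrArg (coord f q p _) (map_smul (elMap (GroupAt.mapOf φ)) π z)).trans
      ((map_smul (coord f q p _) π _).trans hm)
  have hφ := congrArg (elMap (GroupAt.mapOf φ)) hcancel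
  rw [elMap_mapOf_fibreMul] at hφ
  have h₃ := elMap_mapOf_fibreMul φ z (π • z) h₁
  have h₄ := (congrArg (coord f q p _) h₃).trans (coord_fibreMul_groupOverOne f q p hm hm' _)
  have h₅ := (coord_fibreMul_groupOverOne f q p h₄ hm _).symm.trans
    ((congrArg (coord f q p _) hφ).trans hm)
  exact congrArg ConstGroup.down (mul_eq_right.mp h₅)

end Coordinates

/-- Homomorphisms out of an internally free group lift along a homomorphism with a section. -/
theorem _root_.InternalLogic.ForcesFreelyGenerates.exists_lift {E : Type u} [Category.{v} E]
    [HasPullbacks E] {U V : E} {H : GroupAt U} {X : Over U} {i : X ⟶ H.set}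
    (hi : ForcesFreelyGenerates H i) (p : V ⟶ U) {K L : GroupAt V} (r : K ⟶ L) (s : L.set ⟶ K.set)
    (hs : s ≫ GroupAt.mapOf r = 𝟙 _) (χ : (GroupAt.restrict p).obj H ⟶ L) :
    ∃ φ : (GroupAt.restrict p).obj H ⟶ K, φ ≫ r = χ := by
  obtain ⟨φ, hφ, -⟩ := hi p K ((Over.pullback p).map i ≫ GroupAt.mapOf χ ≫ s)
  -- The section `s` is only a map of sets, but `φ ≫ r` and `χ` are homomorphisms that agree on `X`.
  refine ⟨φ, (hi p L ((Over.pullback p).map i ≫ GroupAt.mapOf χ)).unique ?_ rfl⟩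
  have cancel (x : (Over.pullback p).obj X ⟶ (Over.pullback p).obj H.set)
      (y : (Over.pullback p).obj H.set ⟶ L.set) : (x ≫ y ≫ s) ≫ GroupAt.mapOf r = x ≫ y := by
    rw [Category.assoc, Category.assoc, hs, Category.comp_id]
  exact (Category.assoc _ _ _).symm.trans
    ((congrArg (· ≫ GroupAt.mapOf r) hφ).trans (cancel _ (GroupAt.mapOf χ)))

/-- The point `w` supplies a transposition fixing it. The lift of χ to ℤ/4 is automatically
equivariant, so no separate invariance argument on `X` is required. -/
theorem not_forcesFreelyGenerates_commutatorGroup [Infinite 𝔸] {W : NominalSet 𝔸}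
    (f : V ⟶ one 𝔸) (q : W ⟶ V) (w : W.carrier) {X : Over W}
    (i : X ⟶ ((GroupAt.restrict q).obj ((GroupAt.restrict f).obj (commutatorGroup 𝔸))).set) :
    ¬ ForcesFreelyGenerates
      ((GroupAt.restrict q).obj ((GroupAt.restrict f).obj (commutatorGroup 𝔸))) i := by
  classical
  intro hfree
  obtain ⟨χ, hχ⟩ := exists_commutatorParity 𝔸
  obtain ⟨a, b, hab, hfix⟩ := (W.finitelySupported w).exists_swap_smul_eq
  -- The universal property is used at the stage `W` itself, but its statement still pulls back
  -- along the identity; hence the third restriction step.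
  let p := 𝟙 W
  let R := restrict₃ f q p
  let S := restrictSet₃ f q p
  let χ' : commutatorGroup 𝔸 ⟶ constGroup 𝔸 (Multiplicative (ZMod 2)) :=
    toConstGroup _ χ (commutatorParity_smul hχ)
  let r : constGroup 𝔸 (Multiplicative (ZMod 4)) ⟶ constGroup 𝔸 (Multiplicative (ZMod 2)) :=
    constGroupMap reduceMod2
  let s : (constGroup 𝔸 (Multiplicative (ZMod 2))).X ⟶ (constGroup 𝔸 (Multiplicative (ZMod 4))).X :=
    constSetMap liftMod4
  have hs : S.map s ≫ S.map (GroupAt.mapOf r) = 𝟙 _ :=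
    (S.map_comp _ _).symm.trans
      ((congrArg S.map (constSetMap_comp _ _ reduceMod2_liftMod4)).trans (S.map_id _))
  obtain ⟨φ, hφr⟩ := hfree.exists_lift p (R.map r) (S.map s) hs (R.map χ')
  obtain ⟨z, hz, hzw⟩ := exists_coord_eq f q p (Y := (commutatorGroup 𝔸).X)
    (letterCommutator a b : commutatorSubgroupOfLetters 𝔸) w
  refine reduceMod2_of_mul_self _ (mul_self_of_smul_eq_inv f q p φ (atomSwap a b) z hz
    (atomSwap_smul_letterCommutator a b) ((congrArg _ hzw).trans (hfix.trans hzw.symm)) rfl) ?_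
  rw [← hχ a b hab]
  have h₁ := (coord_map f q p (GroupAt.mapOf χ') z).trans (congrArg (elMap _) hz)
  have h₂ := coord_map f q p (GroupAt.mapOf r) (elMap (GroupAt.mapOf φ) z)
  have h₃ : elMap (S.map (GroupAt.mapOf r)) (elMap (GroupAt.mapOf φ) z) =
      elMap (S.map (GroupAt.mapOf χ')) z :=
    congrArg (fun ψ => elMap (GroupAt.mapOf ψ) z) hφr
  exact congrArg (ConstGroup.down (𝔸 := 𝔸)) (h₂.symm.trans ((congrArg (coord f q p _) h₃).trans h₁))

/-! ### Initial stages and the negated statements -/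

/-- The empty nominal set. -/
def empty (𝔸 : Type u) : NominalSet 𝔸 where
  carrier := PEmpty
  action := { smul := fun _ x => x, one_smul := fun _ => rfl, mul_smul := fun _ _ _ => rfl }
  finitelySupported := fun x => x.elim

theorem isEmpty_of_isInitial (h : IsInitial V) : IsEmpty V.carrier :=
  ⟨fun v => (toMap (h.to (empty 𝔸)) v : PEmpty).elim⟩

theorem nonempty_isInitial [IsEmpty V.carrier] : Nonempty (IsInitial V) :=
  ⟨IsInitial.ofUniqueHom
    (fun _ => ofMap { toFun := fun v => isEmptyElim v, map_smul' := fun _ v => isEmptyElim v })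
    fun _ _ => hom_ext fun v => isEmptyElim v⟩

/-- Two points with the trivial action. -/
def two (𝔸 : Type u) : NominalSet 𝔸 where
  carrier := ULift Bool
  action := { smul := fun _ x => x, one_smul := fun _ => rfl, mul_smul := fun _ _ _ => rfl }
  finitelySupported := fun _ => ⟨∅, Set.finite_empty, fun _ _ => rfl⟩

/-- The two constant maps from `V` to `two 𝔸` would agree on an empty cover, yet they differ on `V`.
-/
theorem nonempty_of_epi {W : NominalSet 𝔸} (q : W ⟶ V) [Epi q] [Nonempty V.carrier] :
    Nonempty W.carrier := by
  by_contra hW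
  rw [not_nonempty_iff] at hW
  let k (b : Bool) : V ⟶ two 𝔸 :=
    ofMap (Y := two 𝔸) { toFun := fun _ => ULift.up b, map_smul' := fun _ _ => rfl }
  have h : k true = k false := (cancel_epi q).mp (hom_ext fun w => isEmptyElim w)
  obtain ⟨v⟩ := ‹Nonempty V.carrier›
  have := congrArg ULift.down
    (DFunLike.congr_fun (congrArg toMap h) v : ULift.up true = ULift.up false)
  exact Bool.noConfusion this

theorem forcesNot_hasFreeGeneratingSubset (𝔸 : Type u) [Infinite 𝔸] :
    ForcesNot (one 𝔸) fun V f =>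
      ForcesHasFreeGeneratingSubset V ((GroupAt.restrict f).obj (commutatorGroup 𝔸)) := by
  rintro V f ⟨W, q, X, i, hq, -, hfree⟩
  rcases isEmpty_or_nonempty V.carrier with hV | hV
  · exact nonempty_isInitial
  · obtain ⟨w⟩ := nonempty_of_epi q
    exact absurd hfree (not_forcesFreelyGenerates_commutatorGroup f q w i)

theorem mono_commutatorInclusion (𝔸 : Type u) :
    Mono (GroupAt.mapOf (commutatorInclusion 𝔸)) :=
  ⟨fun _ _ h => over_hom_ext fun x =>
    Subtype.val_injective (p := (· ∈ commutatorSubgroupOfLetters 𝔸))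
      (DFunLike.congr_fun (congrArg elMap h) x)⟩

theorem forcesNot_nielsenSchreier (𝔸 : Type u) [Infinite 𝔸] :
    ForcesNot (one 𝔸) fun V _ => ForcesNielsenSchreier V := fun V f h =>
  forcesNot_hasFreeGeneratingSubset 𝔸 V f <|
    h (𝟙 V) _ _ _ ((fibrewiseFree_letters 𝔸).restrict f).forcesFreelyGenerates _
      ((GroupAt.restrict f).map (commutatorInclusion 𝔸)) <| by
        have := mono_commutatorInclusion 𝔸
        -- Right adjoints preserve monomorphisms, so the restriction of C is still a subgroup of the
        -- restriction of F_𝔸.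
        have : (Over.pullback f).IsRightAdjoint := (Over.mapPullbackAdj f).isRightAdjoint
        exact inferInstanceAs (Mono ((Over.pullback f).map (GroupAt.mapOf (commutatorInclusion 𝔸))))

end NominalSet

theorem theorem6p3 (𝔸 : Type u) [Countable 𝔸] [Infinite 𝔸] :
    -- the Nielsen-Schreier theorem does not hold in the internal logic of nominal sets,
    -- and its negation does
    ¬ InternalLogic.ForcesNielsenSchreier (NominalSet.one 𝔸) ∧
    InternalLogic.ForcesNot (NominalSet.one 𝔸)
      (fun V _ => InternalLogic.ForcesNielsenSchreier V) ∧
    -- witness, internally: `F_𝔸` is the free group on `𝔸`, `C` is a subgroup of it, and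
    -- it is forced that no subset of `C` freely generates `C`
    InternalLogic.ForcesFreelyGenerates (NominalSet.freeGroup 𝔸) (NominalSet.letters 𝔸) ∧
    Mono (InternalLogic.GroupAt.mapOf (NominalSet.commutatorInclusion 𝔸)) ∧
    InternalLogic.ForcesNot (NominalSet.one 𝔸)
      (fun V f => InternalLogic.ForcesHasFreeGeneratingSubset V
        ((InternalLogic.GroupAt.restrict f).obj (NominalSet.commutatorGroup 𝔸))) ∧
    -- witness, externally: no finitely supported subset of `C` freely generates `C`
    ¬ ∃ X : Set (FreeGroup 𝔸), FinitelySupported 𝔸 X ∧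
        FreelyGenerates X (commutatorSubgroupOfLetters 𝔸) := by
  exact
    -- Otherwise the terminal object would be initial, hence empty, although it has a point.
    ⟨fun h => (NominalSet.forcesNot_nielsenSchreier 𝔸 _ (𝟙 _) h).elim fun h =>
        (NominalSet.isEmpty_of_isInitial h).elim PUnit.unit,
      NominalSet.forcesNot_nielsenSchreier 𝔸,
      (NominalSet.fibrewiseFree_letters 𝔸).forcesFreelyGenerates,
      NominalSet.mono_commutatorInclusion 𝔸,
      NominalSet.forcesNot_hasFreeGeneratingSubset 𝔸,
      fun ⟨X, hX, h⟩ => not_freelyGenerates_commutatorSubgroupOfLetters X hX h⟩
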